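/- A sequence $M=(M_k)_{k\in\mathbb N}$ of positive reals is a DC-weight sequence if $M_0=1$, $M_{k+1}\ge M_k$ for all $k$, $M_k^2\le M_{k-1}M_{k+1}$ for all $k\ge1$, and $\sup_{k\ge 1}(M_{k+1}/M_k)^{1/k}<\infty$. For $U\subseteq\mathbb R^n$ open, $C^M(U)$ is the set of all $f\in C^\infty(U)$ such that for each compact $K\subseteq U$ there are $C,\rho>0$ with $|\partial^\alpha f(x)|\le C\rho^{|\alpha|}|\alpha|!\,M_{|\alpha|}$ for all $\alpha\in\mathbb N^n$ and $x\in K$. $M$ is quasianalytic if for all $n$, all open connected $U\subseteq\mathbb R^n$ and all $a\in U$ the map sending $f\in C^M(U)$ to its formal Taylor series at $a$ is injective; otherwise $M$ is non-quasianalytic. A convenient vector space is a real Hausdorff locally convex space $E$ in which every Mackey–Cauchy sequence converges, where $(x_n)$ is Mackey–Cauchy if $r_{nm}(x_n-x_m)\to0$ for some reals $r_{nm}\to\infty$. For a sequence $\mu=(\mu_n)$ with $0<\mu_n\nearrow\infty$, a sequence $x_n$ in $E$ is $\mu$-converging to $x\in E$ if $\{\mu_n(x_n-x):n\in\mathbb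 N\}$ is bounded. A curve $c:\mathbb R\to E$ is strongly uniformly $C^M$ if it is smooth (all derivatives exist) and there is $\rho>0$ such that $\{c^{(k)}(x)/(\rho^k\,k!\,M_k): k\in\mathbb N,\ x\in\mathbb R\}$ is bounded in $E$. **Lemma 3.6** ($C^M$ curve lemma). Let $M$ be a non-quasianalytic DC-weight sequence. Then there exist real sequences $\lambda_k\searrow 0$ with $\lambda_k>0$, $t_k\to t_\infty\in\mathbb R$, and $s_k>0$ with the following property: for every convenient vector space $E$, every sequence $(x_n)$ in $E$ which is $1/\lambda$-converging to some $x_\infty\in E$, and every sequence $(v_n)$ in $E$ which is $1/\lambda$-converging to $0$ (where $1/\lambda=(1/\lambda_n)_n$), there exists a strongly uniformly $C^M$ curve $c:\mathbb R\to E$ with $$c(t_k+t)=x_k+t\,v_k\qquad\text{for all }k\in\mathbb N\text{ and all } t\in\mathbb R\text{ with }|t|\le s_k.$$ -/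

import Mathlib

open Filter Set Topology
open scoped ContDiff Nat

noncomputable section

/-- DC-weight sequence: positive, `M 0 = 1`, increasing, logarithmically convex and
stable under derivation, i.e. `sup_{k ≥ 1} (M (k+1) / M k) ^ (1/k) < ∞`. -/
structure IsDCWeight (M : ℕ → ℝ) : Prop where
  pos : ∀ k, 0 < M k
  zero : M 0 = 1
  mono : ∀ k, M k ≤ M (k + 1)
  logConvex : ∀ k, 1 ≤ k → M k ^ 2 ≤ M (k - 1) * M (k + 1)
  derivClosed : ∃ C : ℝ, ∀ k : ℕ, 1 ≤ k → (M (k + 1) / M k) ^ (1 / (k : ℝ)) ≤ C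

/-- The partial derivative in the `i`-th coordinate direction. -/
def partialDeriv {n : ℕ} (i : Fin n) (f : EuclideanSpace ℝ (Fin n) → ℝ) :
    EuclideanSpace ℝ (Fin n) → ℝ :=
  fun x => fderiv ℝ f x (EuclideanSpace.single i (1 : ℝ))

/-- The iterated partial derivative `∂^α f = ∂_0^{α 0} ⋯ ∂_{n-1}^{α (n-1)} f`. -/
def multiDeriv {n : ℕ} (α : Fin n →₀ ℕ) (f : EuclideanSpace ℝ (Fin n) → ℝ) :
    EuclideanSpace ℝ (Fin n) → ℝ :=
  (List.finRange n).foldr (fun i g => (partialDeriv i)^[α i] g) f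

/-- Membership in the Denjoy–Carleman class `C^M(U)`, for `U` open in `ℝⁿ`. Elements of `C^M(U)`
are represented by functions on `ℝⁿ`, of which only the restriction to `U` matters. -/
def IsDenjoyCarleman (M : ℕ → ℝ) {n : ℕ} (U : Set (EuclideanSpace ℝ (Fin n)))
    (f : EuclideanSpace ℝ (Fin n) → ℝ) : Prop :=
  ContDiffOn ℝ ∞ f U ∧
    ∀ K : Set (EuclideanSpace ℝ (Fin n)), IsCompact K → K ⊆ U →
      ∃ C ρ : ℝ, 0 < C ∧ 0 < ρ ∧ ∀ (α : Fin n →₀ ℕ), ∀ x ∈ K,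
        |multiDeriv α f x| ≤ C * ρ ^ (∑ i, α i) * ((∑ i, α i)! : ℝ) * M (∑ i, α i)

/-- The Taylor series `∑_α (1/α!) ∂^α f(a) X^α` as a formal power series. -/
def taylorSeriesAt {n : ℕ} (f : EuclideanSpace ℝ (Fin n) → ℝ) (a : EuclideanSpace ℝ (Fin n)) :
    MvPowerSeries (Fin n) ℝ :=
  fun α => (∏ i, ((α i)! : ℝ))⁻¹ * multiDeriv α f a

/-- `C^M` is quasianalytic: for every open connected `U ⊆ ℝⁿ` and every `a ∈ U`
the Taylor series homomorphism at `a` is injective on `C^M(U)`. -/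
def IsQuasianalytic (M : ℕ → ℝ) : Prop :=
  ∀ (n : ℕ) (U : Set (EuclideanSpace ℝ (Fin n))), IsOpen U → IsConnected U → ∀ a ∈ U,
    ∀ f g : EuclideanSpace ℝ (Fin n) → ℝ, IsDenjoyCarleman M U f → IsDenjoyCarleman M U g →
      taylorSeriesAt f a = taylorSeriesAt g a → EqOn f g U

section LocallyConvex

variable {E : Type*} [AddCommGroup E] [Module ℝ E] [TopologicalSpace E]

/-- `c^∞`-completeness: every Mackey–Cauchy sequence converges. A (Hausdorff) locally convex
space with this property is called convenient. -/
def IsConvenient (E : Type*) [AddCommGroup E] [Module ℝ E] [TopologicalSpace E] : Prop :=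
  ∀ x : ℕ → E,
    (∃ r : ℕ × ℕ → ℝ, Tendsto r atTop atTop ∧
      Tendsto (fun p : ℕ × ℕ => r p • (x p.1 - x p.2)) atTop (𝓝 0)) →
    ∃ y : E, Tendsto x atTop (𝓝 y)

/-- The sequence `x` is `μ`-converging to `y`: the set of all `μ_n (x_n - y)` is bounded. -/
def MackeyConverges (μ : ℕ → ℝ) (x : ℕ → E) (y : E) : Prop :=
  Bornology.IsVonNBounded ℝ (range fun n => μ n • (x n - y))

/-- `c' t` is the derivative of the curve `c` at `t`, for all `t`. -/
def IsCurveDeriv (c c' : ℝ → E) : Prop :=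
  ∀ t : ℝ, Tendsto (fun h : ℝ => h⁻¹ • (c (t + h) - c t)) (𝓝[≠] 0) (𝓝 (c' t))

/-- `d k` is the `k`-th derivative `c^{(k)}` of the curve `c`, for every `k`. The curve `c` is
smooth if and only if such a `d` exists (each `d k` is continuous, being differentiable),
and `d` is then unique if `E` is Hausdorff. -/
def IsDerivTower (c : ℝ → E) (d : ℕ → ℝ → E) : Prop :=
  d 0 = c ∧ ∀ k, IsCurveDeriv (d k) (d (k + 1))

/-- The curve `c` is strongly uniformly `C^M`: it is smooth and for some `ρ > 0` the set of all
`c^{(k)}(x) / (ρ^k k! M_k)`, with `k ∈ ℕ` and `x ∈ ℝ`, is bounded in `E`. -/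
def IsStronglyUniformlyCM (M : ℕ → ℝ) (c : ℝ → E) : Prop :=
  ∃ d : ℕ → ℝ → E, IsDerivTower c d ∧ ∃ ρ : ℝ, 0 < ρ ∧
    Bornology.IsVonNBounded ℝ
      {y : E | ∃ (k : ℕ) (x : ℝ), y = (ρ ^ k * (k ! : ℝ) * M k)⁻¹ • d k x}

end LocallyConvex

end

/-! ### Scalar derivative towers with Denjoy–Carleman bounds -/

/-! The curve is c(t) = x_∞ + ∑ⱼ χⱼ(t - tⱼ) (xⱼ - x_∞ + (t - tⱼ) vⱼ) with tⱼ = 2^(-j) and cut-offs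
χⱼ equal to 1 near 0, supported so narrowly that the terms have disjoint supports. The crux is to
have all χⱼ satisfy C^M bounds with one common ρ, only the constants Cⱼ growing
(`exists_cutoff_of_not_isQuasianalytic`). Then λⱼ is chosen with λⱼ Cⱼ ≤ 4^(-j). Since (xⱼ - x_∞)/λⱼ
and vⱼ/λⱼ are bounded, every derivative of c is a scalar of size O(4^(-j)) times an element of a
bounded set, plus x_∞ in order 0. Near t = 0 this factor is O(t²), which gives smoothness there
(`isCurveDeriv_glue`, `isVonNBounded_glue`).

The common ρ arises as follows. Non-quasianalyticity and connectedness give a point z where two C^M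
functions have equal derivatives, yet differ arbitrarily close to z (`exists_flat_point`). Their
difference along a short segment from z is flat at one end and nonzero further on, with bounds
inherited from one fixed ball. Products, one integration and reflections turn it into a cut-off,
multiplying ρ by a fixed power of 2. -/

/-- `d k` has derivative `d (k + 1)` at every point of `S`. -/
def IsTowerOn (S : Set ℝ) (d : ℕ → ℝ → ℝ) : Prop :=
  ∀ k, ∀ t ∈ S, HasDerivAt (d k) (d (k + 1) t) t

/-- The bounds `|d k| ≤ C ρ ^ k k! M k` on `S`. -/
def IsCMBoundOn (M : ℕ → ℝ) (S : Set ℝ) (C ρ : ℝ) (d : ℕ → ℝ → ℝ) : Prop :=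
  ∀ k, ∀ t ∈ S, |d k t| ≤ C * (ρ ^ k * (k ! : ℝ) * M k)

/-- The tower of a product, given by the Leibniz rule. -/
def leibniz (f g : ℕ → ℝ → ℝ) (k : ℕ) (t : ℝ) : ℝ :=
  ∑ ij ∈ Finset.HasAntidiagonal.antidiagonal k, (k.choose ij.1 : ℝ) * (f ij.1 t * g ij.2 t)

theorem IsDCWeight.ratio_mono {M : ℕ → ℝ} (hM : IsDCWeight M) :
    Monotone fun k => M (k + 1) / M k := by
  refine monotone_nat_of_le_succ fun k => ?_
  have h := hM.logConvex (k + 1) (by omega)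
  rw [div_le_div_iff₀ (hM.pos _) (hM.pos _)]
  simp only [Nat.add_sub_cancel] at h
  nlinarith [h]

/-- The ratios M (k+1) / M k increase, so the j factors leading from M i to M (i+j) dominate those
leading from M 0 = 1 to M j. -/
theorem IsDCWeight.mul_le {M : ℕ → ℝ} (hM : IsDCWeight M) (i j : ℕ) :
    M i * M j ≤ M (i + j) := by
  induction j with
  | zero => simp [hM.zero]
  | succ j ih =>
    have e : ∀ k, M (k + 1) = M k * (M (k + 1) / M k) := fun k => by
      field_simp [(hM.pos k).ne']
    have hr : M (j + 1) / M j ≤ M (i + j + 1) / M (i + j) := hM.ratio_mono (by omega)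
    have hp : 0 ≤ M (j + 1) / M j := (div_pos (hM.pos _) (hM.pos _)).le
    rw [← add_assoc, e (i + j), e j, ← mul_assoc]
    exact mul_le_mul ih hr hp (hM.pos _).le

theorem IsTowerOn.leibniz {S : Set ℝ} {f g : ℕ → ℝ → ℝ} (hf : IsTowerOn S f)
    (hg : IsTowerOn S g) : IsTowerOn S (leibniz f g) := by
  intro k t ht
  have h : HasDerivAt (fun t => ∑ ij ∈ Finset.HasAntidiagonal.antidiagonal k,
      (k.choose ij.1 : ℝ) * (f ij.1 t * g ij.2 t))
      (∑ ij ∈ Finset.HasAntidiagonal.antidiagonal k, (k.choose ij.1 : ℝ) *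
        (f (ij.1 + 1) t * g ij.2 t + f ij.1 t * g (ij.2 + 1) t)) t :=
    HasDerivAt.fun_sum fun ij _ => ((hf _ t ht).mul (hg _ t ht)).const_mul _
  refine h.congr_deriv ?_
  rw [_root_.leibniz, Finset.sum_antidiagonal_choose_succ_mul (fun i j => f i t * g j t) k,
    ← Finset.sum_add_distrib]
  refine Finset.sum_congr rfl fun ij hij => ?_
  rw [Nat.choose_symm_of_eq_add (Finset.HasAntidiagonal.mem_antidiagonal.1 hij).symm]
  ring

/-- The binomial coefficient turns i! j! into k!, and `IsDCWeight.mul_le` handles the weights. The k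
+ 1 summands are absorbed by 2 ^ k, whence the rate 2ρ. -/
theorem IsCMBoundOn.leibniz {M : ℕ → ℝ} (hM : IsDCWeight M) {S : Set ℝ} {C D ρ : ℝ}
    (hC : 0 ≤ C) (hD : 0 ≤ D) (hρ : 0 < ρ) {f g : ℕ → ℝ → ℝ} (hf : IsCMBoundOn M S C ρ f)
    (hg : IsCMBoundOn M S D ρ g) : IsCMBoundOn M S (C * D) (2 * ρ) (leibniz f g) := by
  intro k t ht
  have hb : ∀ ij ∈ Finset.HasAntidiagonal.antidiagonal k,
      |(k.choose ij.1 : ℝ) * (f ij.1 t * g ij.2 t)| ≤ C * D * (ρ ^ k * (k ! : ℝ) * M k) := by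
    rintro ⟨i, j⟩ hij
    obtain rfl := Finset.HasAntidiagonal.mem_antidiagonal.1 hij
    have h1 : |f i t| * |g j t| ≤
        (C * (ρ ^ i * (i ! : ℝ) * M i)) * (D * (ρ ^ j * (j ! : ℝ) * M j)) :=
      mul_le_mul (hf i t ht) (hg j t ht) (abs_nonneg _)
        (by have := hM.pos i; positivity)
    have h2 : (((i + j).choose i : ℕ) : ℝ) * (i ! : ℝ) * (j ! : ℝ) = ((i + j)! : ℝ) := by
      rw [Nat.choose_symm_add]
      exact_mod_cast Nat.add_choose_mul_factorial_mul_factorial i j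
    rw [abs_mul, abs_mul, Nat.abs_cast]
    calc (((i + j).choose i : ℕ) : ℝ) * (|f i t| * |g j t|)
        ≤ (((i + j).choose i : ℕ) : ℝ) *
          ((C * (ρ ^ i * (i ! : ℝ) * M i)) * (D * (ρ ^ j * (j ! : ℝ) * M j))) := by gcongr
      _ = C * D * (ρ ^ (i + j) * ((((i + j).choose i : ℕ) : ℝ) * (i ! : ℝ) * (j ! : ℝ)) *
          (M i * M j)) := by rw [pow_add]; ring
      _ ≤ _ := by rw [h2]; gcongr; exact hM.mul_le i j
  have hk : ((k : ℝ) + 1) ≤ 2 ^ k := by exact_mod_cast (Nat.lt_two_pow_self (n := k))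
  have hMk := hM.pos k
  calc |_root_.leibniz f g k t| ≤ _ := Finset.abs_sum_le_sum_abs _ _
    _ ≤ _ := Finset.sum_le_card_nsmul _ _ _ hb
    _ = ((k : ℝ) + 1) * (C * D * (ρ ^ k * (k ! : ℝ) * M k)) := by
      rw [Finset.Nat.card_antidiagonal, nsmul_eq_mul]; push_cast; ring
    _ ≤ 2 ^ k * (C * D * (ρ ^ k * (k ! : ℝ) * M k)) := by gcongr
    _ = _ := by rw [mul_pow]; ring

theorem IsTowerOn.comp_add {S : Set ℝ} {d : ℕ → ℝ → ℝ} (hd : IsTowerOn S d) (a : ℝ) :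
    IsTowerOn {t | t + a ∈ S} fun k t => d k (t + a) :=
  fun k _ ht => (hd k _ ht).comp_add_const _ _

theorem IsTowerOn.comp_const_sub {S : Set ℝ} {d : ℕ → ℝ → ℝ} (hd : IsTowerOn S d) (a : ℝ) :
    IsTowerOn {t | a - t ∈ S} fun k t => (-1) ^ k * d k (a - t) := by
  intro k t ht
  refine (((hd k _ ht).comp_const_sub a t).const_mul ((-1) ^ k)).congr_deriv ?_
  change _ = (-1) ^ (k + 1) * d (k + 1) (a - t)
  rw [pow_succ]; ring

theorem IsCMBoundOn.comp_const_sub {M : ℕ → ℝ} {S : Set ℝ} {C ρ : ℝ} {d : ℕ → ℝ → ℝ}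
    (hd : IsCMBoundOn M S C ρ d) (a : ℝ) :
    IsCMBoundOn M {t | a - t ∈ S} C ρ fun k t => (-1) ^ k * d k (a - t) := by
  intro k t ht
  simpa [abs_mul] using hd k _ ht

/-- Extension by zero of a function vanishing to first order at the end points. -/
theorem hasDerivAt_indicator_Icc {a b : ℝ} {F F' : ℝ → ℝ}
    (hF : ∀ t ∈ Icc a b, HasDerivAt F (F' t) t) (ha : F a = 0) (ha' : F' a = 0)
    (hb : F b = 0) (hb' : F' b = 0) (t : ℝ) :
    HasDerivAt ((Icc a b).indicator F) ((Icc a b).indicator F' t) t := by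
  by_cases ht : t ∈ Icc a b
  · by_cases hi : t ∈ Ioo a b
    · rw [indicator_of_mem ht]
      refine (hF t ht).congr_of_eventuallyEq ?_
      filter_upwards [isOpen_Ioo.mem_nhds hi] with s hs
      exact indicator_of_mem (Ioo_subset_Icc_self hs) _
    · have hz : F t = 0 ∧ F' t = 0 := by
        rcases eq_or_lt_of_le ht.1 with rfl | h1
        · exact ⟨ha, ha'⟩
        · rcases eq_or_lt_of_le ht.2 with rfl | h2
          · exact ⟨hb, hb'⟩
          · exact absurd ⟨h1, h2⟩ hi
      have h := hF t ht
      rw [indicator_of_mem ht, hz.2]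
      rw [hz.2, hasDerivAt_iff_isLittleO] at h
      rw [hasDerivAt_iff_isLittleO]
      simp only [indicator_of_mem ht, hz.1, smul_zero, sub_zero] at h ⊢
      -- The truncated function is pointwise no larger than F, so it inherits F = o(s - t).
      refine Asymptotics.IsBigO.trans_isLittleO (Asymptotics.isBigO_of_le _ fun s => ?_) h
      by_cases hs : s ∈ Icc a b <;> simp [hs]
  · rw [indicator_of_notMem ht]
    have : (Icc a b).indicator F =ᶠ[𝓝 t] fun _ => 0 := by
      filter_upwards [isClosed_Icc.isOpen_compl.mem_nhds ht] with s hs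
      exact indicator_of_notMem hs _
    exact (hasDerivAt_const t (0 : ℝ)).congr_of_eventuallyEq this

theorem IsCMBoundOn.mono {M : ℕ → ℝ} (hM : IsDCWeight M) {S : Set ℝ} {C D ρ σ : ℝ}
    (hρ : 0 ≤ ρ) (hD : 0 ≤ D) (hCD : C ≤ D) (hρσ : ρ ≤ σ) {d : ℕ → ℝ → ℝ}
    (hd : IsCMBoundOn M S C ρ d) : IsCMBoundOn M S D σ d := by
  intro k t ht
  have := hM.pos k
  calc |d k t| ≤ C * (ρ ^ k * (k ! : ℝ) * M k) := hd k t ht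
    _ ≤ D * (ρ ^ k * (k ! : ℝ) * M k) := by gcongr
    _ ≤ _ := by gcongr

theorem leibniz_eq_zero {f g : ℕ → ℝ → ℝ} {t : ℝ} (h : (∀ k, f k t = 0) ∨ ∀ k, g k t = 0)
    (k : ℕ) : leibniz f g k t = 0 := by
  refine Finset.sum_eq_zero fun ij _ => ?_
  rcases h with h | h <;> simp [h]

@[simp] theorem leibniz_zero (f g : ℕ → ℝ → ℝ) (t : ℝ) : leibniz f g 0 t = f 0 t * g 0 t := by
  simp [leibniz]

/-! ### From a flat function to a cut-off -/

/-- A tower on `[0, 2a]` which is flat at `0` and does not vanish at `a` gives rise to a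
nonnegative bump supported in `[0, 2a]`. -/
theorem exists_nonneg_bump_of_flat {M : ℕ → ℝ} (hM : IsDCWeight M) {C ρ a : ℝ} (hC : 0 ≤ C)
    (hρ : 0 < ρ) (ha : 0 < a) {q : ℕ → ℝ → ℝ} (hq : IsTowerOn (Icc 0 (2 * a)) q)
    (hb : IsCMBoundOn M (Icc 0 (2 * a)) C ρ q) (h0 : ∀ k, q k 0 = 0) (hne : q 0 a ≠ 0) :
    ∃ ψ : ℕ → ℝ → ℝ, IsTowerOn univ ψ ∧
      IsCMBoundOn M univ (C * C * (C * C)) (2 * (2 * ρ)) ψ ∧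
      (∀ t, 0 ≤ ψ 0 t) ∧ 0 < ψ 0 a ∧ ∀ k, ∀ t ∉ Ioo 0 (2 * a), ψ k t = 0 := by
  have hrefl : Icc 0 (2 * a) ⊆ {t | 2 * a - t ∈ Icc 0 (2 * a)} := fun t ht =>
    ⟨by linarith [ht.2], by linarith [ht.1]⟩
  -- Multiplying by the reflection about a makes the product flat at both ends, while its value at a
  -- is q(a)².
  set p := leibniz q fun k t => (-1) ^ k * q k (2 * a - t) with hp
  have hpt : IsTowerOn (Icc 0 (2 * a)) p :=
    hq.leibniz fun k t ht => hq.comp_const_sub (2 * a) k t (hrefl ht)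
  have hpb : IsCMBoundOn M (Icc 0 (2 * a)) (C * C) (2 * ρ) p :=
    hb.leibniz hM hC hC hρ fun k t ht => hb.comp_const_sub (2 * a) k t (hrefl ht)
  have hp0 : ∀ k, p k 0 = 0 := leibniz_eq_zero (.inl h0)
  have hp1 : ∀ k, p k (2 * a) = 0 := leibniz_eq_zero (.inr fun k => by simp [h0])
  set e : ℕ → ℝ → ℝ := fun k => (Icc 0 (2 * a)).indicator (p k) with he
  have het : IsTowerOn univ e := fun k t _ =>
    hasDerivAt_indicator_Icc (hpt k) (hp0 _) (hp0 _) (hp1 _) (hp1 _) t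
  have heb : IsCMBoundOn M univ (C * C) (2 * ρ) e := by
    intro k t _
    by_cases ht : t ∈ Icc 0 (2 * a)
    · simpa [he, indicator_of_mem ht] using hpb k t ht
    · have := (hM.pos k).le
      simp only [he, indicator_of_notMem ht, abs_zero]
      positivity
  -- Squaring forces nonnegativity.
  refine ⟨leibniz e e, het.leibniz het, heb.leibniz hM (by positivity) (by positivity)
    (by positivity) heb, fun t => ?_, ?_, fun k t ht => leibniz_eq_zero (.inl fun j => ?_) k⟩
  · rw [leibniz_zero]
    exact mul_self_nonneg _
  · have : e 0 a = q 0 a * q 0 a := by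
      have ha' : a ∈ Icc 0 (2 * a) := ⟨ha.le, by linarith⟩
      simp only [he, indicator_of_mem ha', hp, leibniz_zero]
      rw [show 2 * a - a = a by ring]
      ring
    rw [leibniz_zero, this]
    exact mul_self_pos.2 (mul_ne_zero hne hne)
  · by_cases h : t ∈ Icc 0 (2 * a)
    · rcases eq_or_lt_of_le h.1 with rfl | h1
      · simp [he, hp0]
      · rcases eq_or_lt_of_le h.2 with rfl | h2
        · simp [he, hp1]
        · exact absurd ⟨h1, h2⟩ ht
    · exact indicator_of_notMem h _

/-- The normalised primitive of a nonnegative bump: a smooth step from `0` to `1`. -/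
theorem exists_step_of_bump {M : ℕ → ℝ} (hM : IsDCWeight M) {C ρ a b : ℝ}
    (hρ : 0 < ρ) (ha : a ∈ Icc 0 b) (hb0 : 0 < b) {ψ : ℕ → ℝ → ℝ} (hψ : IsTowerOn univ ψ)
    (hb : IsCMBoundOn M univ C ρ ψ) (hnn : ∀ t, 0 ≤ ψ 0 t) (hpos : 0 < ψ 0 a)
    (hsupp : ∀ k, ∀ t ∉ Ioo 0 b, ψ k t = 0) :
    ∃ (D : ℝ) (P : ℕ → ℝ → ℝ), 0 < D ∧ IsTowerOn univ P ∧ IsCMBoundOn M univ D ρ P ∧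
      (∀ k, ∀ t ≤ 0, P k t = 0) ∧ ∀ t, b ≤ t → P 0 t = 1 := by
  have hcont : Continuous (ψ 0) :=
    continuous_iff_continuousAt.2 fun t => (hψ 0 t trivial).continuousAt
  set Q : ℝ → ℝ := fun t => ∫ s in (0 : ℝ)..t, ψ 0 s with hQ
  have hQd : ∀ t, HasDerivAt Q (ψ 0 t) t := fun t => hcont.integral_hasStrictDerivAt 0 t |>.hasDerivAt
  have hQm : Monotone Q := monotone_of_deriv_nonneg (fun t => (hQd t).differentiableAt)
    fun t => by rw [(hQd t).deriv]; exact hnn t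
  have hQ0 : ∀ t ≤ 0, Q t = 0 := by
    intro t ht
    refine (intervalIntegral.integral_congr (g := fun _ => 0) fun s hs => ?_).trans (by simp)
    rw [uIcc_of_ge ht] at hs
    exact hsupp 0 s fun h => absurd h.1 (not_lt.2 hs.2)
  have hQb : ∀ t, b ≤ t → Q t = Q b := by
    intro t ht
    have h1 : ∫ s in b..t, ψ 0 s = 0 := by
      refine (intervalIntegral.integral_congr (g := fun _ => 0) fun s hs => ?_).trans (by simp)
      rw [uIcc_of_le ht] at hs
      exact hsupp 0 s fun h => absurd h.2 (not_lt.2 hs.1)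
    have h2 := intervalIntegral.integral_add_adjacent_intervals
      (hcont.intervalIntegrable (μ := MeasureTheory.volume) 0 b) (hcont.intervalIntegrable b t)
    rw [h1, add_zero] at h2
    exact h2.symm
  have hI : 0 < Q b := intervalIntegral.integral_pos hb0 hcont.continuousOn (fun t _ => hnn t)
    ⟨a, ha, hpos⟩
  have hC : 0 ≤ C := by
    have := (abs_nonneg _).trans (hb 0 0 trivial)
    simpa [hM.zero] using this
  -- The 1 bounds the step itself. Its derivative of order k + 1 is ψ k / Q b, and this shift of
  -- index costs the factor 1 / ρ.
  refine ⟨1 + C / (Q b * ρ), fun k t => k.casesOn (Q t / Q b) fun j => ψ j t / Q b,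
    by positivity, ?_, ?_, ?_, ?_⟩
  · rintro (_ | k) t -
    · exact (hQd t).div_const _
    · exact (hψ k t trivial).div_const _
  · rintro (_ | k) t -
    · have h1 : 0 ≤ Q t := by
        rcases le_total t 0 with h | h
        · exact (hQ0 t h).ge
        · exact (hQ0 0 le_rfl).ge.trans (hQm h)
      have h2 : Q t ≤ Q b := by
        rcases le_total t b with h | h
        · exact hQm h
        · exact (hQb t h).le
      have h3 : 0 ≤ C / (Q b * ρ) := by positivity
      have h4 : Q t / Q b ≤ 1 := (div_le_one hI).2 h2
      change |Q t / Q b| ≤ _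
      simp only [pow_zero, Nat.factorial_zero, Nat.cast_one, hM.zero, mul_one]
      rw [abs_of_nonneg (by positivity)]
      linarith
    · have h1 := hb k t trivial
      have hMk := hM.pos k
      have hMk' := hM.pos (k + 1)
      have h2 : (k ! : ℝ) * M k ≤ ((k + 1)! : ℝ) * M (k + 1) :=
        mul_le_mul (by exact_mod_cast Nat.factorial_le (Nat.le_succ k)) (hM.mono k) hMk.le
          (by positivity)
      change |ψ k t / Q b| ≤ _
      rw [abs_div, abs_of_pos hI, div_le_iff₀ hI]
      calc |ψ k t| ≤ C * ρ ^ k * ((k ! : ℝ) * M k) := by linarith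
        _ ≤ C * ρ ^ k * (((k + 1)! : ℝ) * M (k + 1)) := by gcongr
        _ = (C / (Q b * ρ)) * (ρ ^ (k + 1) * ((k + 1)! : ℝ) * M (k + 1)) * Q b := by
          rw [pow_succ]; field_simp
        _ ≤ _ := by gcongr; linarith
  · rintro (_ | k) t ht
    · simp [hQ0 t ht]
    · change ψ k t / Q b = 0
      rw [hsupp k t fun h => absurd h.1 (not_lt.2 ht), zero_div]
  · intro t ht
    change Q t / Q b = 1
    rw [hQb t ht, div_self hI.ne']

/-- A cut-off function of class `C^M` which is `1` on `[-b, b]` and `0` outside `[-2b, 2b]`. -/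
theorem exists_cutoff_of_step {M : ℕ → ℝ} (hM : IsDCWeight M) {D ρ b : ℝ} (hD : 0 < D)
    (hρ : 0 < ρ) {P : ℕ → ℝ → ℝ} (hP : IsTowerOn univ P)
    (hb : IsCMBoundOn M univ D ρ P) (h0 : ∀ k, ∀ t ≤ 0, P k t = 0)
    (h1 : ∀ t, b ≤ t → P 0 t = 1) :
    ∃ χ : ℕ → ℝ → ℝ, IsTowerOn univ χ ∧ IsCMBoundOn M univ (D * D) (2 * ρ) χ ∧
      (∀ t, |t| ≤ b → χ 0 t = 1) ∧ ∀ k t, 2 * b ≤ |t| → χ k t = 0 := by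
  -- A step rising on [-2b, -b] times one falling on [b, 2b].
  refine ⟨leibniz (fun k t => P k (t + 2 * b)) fun k t => (-1) ^ k * P k (2 * b - t),
    IsTowerOn.leibniz (hP.comp_add _) (hP.comp_const_sub _),
    IsCMBoundOn.leibniz hM hD.le hD.le hρ (fun k t _ => hb k _ trivial) (hb.comp_const_sub _),
    fun t ht => ?_, fun k t ht => leibniz_eq_zero ?_ k⟩
  · obtain ⟨h2, h3⟩ := abs_le.1 ht
    simp [h1 (t + 2 * b) (by linarith), h1 (2 * b - t) (by linarith)]
  · rcases le_abs.1 ht with h | h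
    · exact .inr fun j => by rw [h0 j _ (by linarith), mul_zero]
    · exact .inl fun j => h0 j _ (by linarith)

/-! ### Reduction of non-quasianalyticity to one variable -/

section Multivariate

variable {n : ℕ} {U : Set (EuclideanSpace ℝ (Fin n))} {f g : EuclideanSpace ℝ (Fin n) → ℝ}

/-- The iterated partial derivative along a word of coordinate directions. -/
noncomputable def wordDeriv (L : List (Fin n)) (f : EuclideanSpace ℝ (Fin n) → ℝ) :
    EuclideanSpace ℝ (Fin n) → ℝ :=
  L.foldr partialDeriv f

theorem wordDeriv_cons (i : Fin n) (L : List (Fin n)) :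
    wordDeriv (i :: L) f = partialDeriv i (wordDeriv L f) := rfl

theorem ContDiffOn.partialDeriv (hU : IsOpen U) (hf : ContDiffOn ℝ ∞ f U) (i : Fin n) :
    ContDiffOn ℝ ∞ (partialDeriv i f) U :=
  (hf.fderiv_of_isOpen hU (by simp)).clm_apply contDiffOn_const

theorem ContDiffOn.wordDeriv (hU : IsOpen U) (hf : ContDiffOn ℝ ∞ f U) (L : List (Fin n)) :
    ContDiffOn ℝ ∞ (wordDeriv L f) U := by
  induction L with
  | nil => exact hf
  | cons i L ih => exact ih.partialDeriv hU i

theorem EqOn.partialDeriv (hU : IsOpen U) (h : EqOn f g U) (i : Fin n) :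
    EqOn (partialDeriv i f) (partialDeriv i g) U := fun x hx => by
  simp only [_root_.partialDeriv, (h.eventuallyEq_of_mem (hU.mem_nhds hx)).fderiv_eq]

theorem EqOn.wordDeriv (hU : IsOpen U) (h : EqOn f g U) (L : List (Fin n)) :
    EqOn (wordDeriv L f) (wordDeriv L g) U := by
  induction L with
  | nil => exact h
  | cons i L ih => exact EqOn.partialDeriv hU ih i

theorem partialDeriv_comm (hU : IsOpen U) (hf : ContDiffOn ℝ ∞ f U) (i j : Fin n) :
    EqOn (partialDeriv i (partialDeriv j f)) (partialDeriv j (partialDeriv i f)) U := by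
  intro x hx
  have hfx : ContDiffAt ℝ ∞ f x := hf.contDiffAt (hU.mem_nhds hx)
  have hd : DifferentiableAt ℝ (fderiv ℝ f) x :=
    ((hf.fderiv_of_isOpen (m := ∞) hU (by simp)).contDiffAt (hU.mem_nhds hx)).differentiableAt
      (by simp)
  have key : ∀ i j : Fin n, partialDeriv i (partialDeriv j f) x =
      fderiv ℝ (fderiv ℝ f) x (EuclideanSpace.single i 1) (EuclideanSpace.single j 1) := by
    intro i j
    have : HasFDerivAt (partialDeriv j f)
        ((fderiv ℝ (fderiv ℝ f) x).flip (EuclideanSpace.single j 1)) x := by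
      refine (hd.hasFDerivAt.clm_apply
        (hasFDerivAt_const (EuclideanSpace.single j (1 : ℝ)) x)).congr_fderiv ?_
      simp
    rw [partialDeriv, this.fderiv]
    rfl
  rw [key, key]
  exact ((hfx.of_le (m := 2) (WithTop.coe_le_coe.2 le_top)).isSymmSndFDerivAt (by simp)) _ _

theorem wordDeriv_perm (hU : IsOpen U) (hf : ContDiffOn ℝ ∞ f U) {L L' : List (Fin n)}
    (h : L.Perm L') : EqOn (wordDeriv L f) (wordDeriv L' f) U := by
  induction h with
  | nil => exact fun _ _ => rfl
  | cons i _ ih => exact EqOn.partialDeriv hU ih i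
  | swap i j L => exact partialDeriv_comm hU (hf.wordDeriv hU L) j i
  | trans _ _ ih ih' => exact ih.trans ih'

/-- A multi-index is a sorted word. Words can be extended by a letter without reordering, which
suits differentiation along a line. -/
theorem multiDeriv_eq_wordDeriv (α : Fin n →₀ ℕ) :
    multiDeriv α f =
      wordDeriv ((List.finRange n).flatMap fun i => List.replicate (α i) i) f := by
  have hrep : ∀ (i : Fin n) (m : ℕ) (h : EuclideanSpace ℝ (Fin n) → ℝ),
      (partialDeriv i)^[m] h = wordDeriv (List.replicate m i) h := by
    intro i m h
    induction m with
    | zero => rfl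
    | succ m ih => rw [Function.iterate_succ_apply', ih]; rfl
  rw [multiDeriv]
  induction List.finRange n with
  | nil => rfl
  | cons i l ih =>
    rw [List.foldr_cons, ih, hrep, List.flatMap_cons, wordDeriv, wordDeriv, wordDeriv,
      List.foldr_append]

theorem ContDiffOn.multiDeriv (hU : IsOpen U) (hf : ContDiffOn ℝ ∞ f U) (α : Fin n →₀ ℕ) :
    ContDiffOn ℝ ∞ (multiDeriv α f) U := by
  rw [multiDeriv_eq_wordDeriv]
  exact hf.wordDeriv hU _

theorem wordDeriv_eq_multiDeriv (hU : IsOpen U) (hf : ContDiffOn ℝ ∞ f U) (L : List (Fin n)) :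
    EqOn (wordDeriv L f) (multiDeriv (Finsupp.equivFunOnFinite.symm fun i => L.count i) f) U := by
  rw [multiDeriv_eq_wordDeriv]
  refine wordDeriv_perm hU hf (List.perm_iff_count.2 fun i => ?_)
  simp [List.count_flatMap, Function.comp_def, List.count_replicate, ← Fin.sum_univ_def]

theorem abs_wordDeriv_le {M : ℕ → ℝ} {K : Set (EuclideanSpace ℝ (Fin n))} {C ρ : ℝ}
    (hU : IsOpen U) (hf : ContDiffOn ℝ ∞ f U) (hK : K ⊆ U)
    (h : ∀ (α : Fin n →₀ ℕ), ∀ x ∈ K,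
      |multiDeriv α f x| ≤ C * ρ ^ (∑ i, α i) * ((∑ i, α i)! : ℝ) * M (∑ i, α i))
    (L : List (Fin n)) {x : EuclideanSpace ℝ (Fin n)} (hx : x ∈ K) :
    |wordDeriv L f x| ≤ C * (ρ ^ L.length * (L.length ! : ℝ) * M L.length) := by
  rw [wordDeriv_eq_multiDeriv hU hf L (hK hx)]
  have := h (Finsupp.equivFunOnFinite.symm fun i => L.count i) x hx
  have hs : ∑ i, (Finsupp.equivFunOnFinite.symm fun i => L.count i) i = L.length := by
    simpa using Multiset.sum_count_eq_card (s := Finset.univ) (m := (L : Multiset (Fin n)))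
      (fun _ _ => Finset.mem_univ _)
  rw [hs] at this
  linarith

/-- The derivatives of `t ↦ f (z + t w)`. -/
noncomputable def lineTower (f : EuclideanSpace ℝ (Fin n) → ℝ) (z w : EuclideanSpace ℝ (Fin n)) (k : ℕ)
    (t : ℝ) : ℝ :=
  ∑ r : Fin k → Fin n, (∏ j, w (r j)) * wordDeriv (List.ofFn r) f (z + t • w)

theorem hasDerivAt_wordDeriv_line (hU : IsOpen U) (hf : ContDiffOn ℝ ∞ f U) (L : List (Fin n))
    {z w : EuclideanSpace ℝ (Fin n)} {t : ℝ} (ht : z + t • w ∈ U) :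
    HasDerivAt (fun t => wordDeriv L f (z + t • w))
      (∑ i, w i * wordDeriv (i :: L) f (z + t • w)) t := by
  have hd : DifferentiableAt ℝ (wordDeriv L f) (z + t • w) :=
    ((hf.wordDeriv hU L).contDiffAt (hU.mem_nhds ht)).differentiableAt (by simp)
  have hl : HasDerivAt (fun t : ℝ => z + t • w) w t := by
    simpa using ((hasDerivAt_id t).smul_const w).const_add z
  refine (hd.hasFDerivAt.comp_hasDerivAt t hl).congr_deriv ?_
  have hw : w = ∑ i, w i • EuclideanSpace.single i (1 : ℝ) := by
    simpa using ((EuclideanSpace.basisFun (Fin n) ℝ).sum_repr w).symm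
  conv_lhs => arg 2; rw [hw]
  simp only [map_sum, map_smul, smul_eq_mul, wordDeriv_cons, partialDeriv]

/-- Differentiating prepends a letter, and words of length k + 1 are pairs of a letter and a word of
length k. -/
theorem isTowerOn_lineTower (hU : IsOpen U) (hf : ContDiffOn ℝ ∞ f U)
    {z w : EuclideanSpace ℝ (Fin n)} {S : Set ℝ} (hS : ∀ t ∈ S, z + t • w ∈ U) :
    IsTowerOn S (lineTower f z w) := by
  intro k t ht
  have h := HasDerivAt.fun_sum (u := Finset.univ) fun (r : Fin k → Fin n) _ =>
    (hasDerivAt_wordDeriv_line hU hf (List.ofFn r) (hS t ht)).const_mul (∏ j, w (r j))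
  refine h.congr_deriv ?_
  rw [lineTower, ← (Fin.consEquiv fun _ => Fin n).sum_comp, Fintype.sum_prod_type_right]
  refine Finset.sum_congr rfl fun r _ => ?_
  rw [Finset.mul_sum]
  refine Finset.sum_congr rfl fun i _ => ?_
  simp only [Fin.consEquiv_apply, Fin.prod_univ_succ, Fin.cons_zero, Fin.cons_succ,
    List.ofFn_succ]
  ring

/-- There are n ^ k words, each with coefficient at most 1 in absolute value, so ρ grows only to n
ρ, whatever the length of the segment. -/
theorem isCMBoundOn_lineTower {M : ℕ → ℝ} {K : Set (EuclideanSpace ℝ (Fin n))} {C ρ : ℝ}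
    (hU : IsOpen U) (hf : ContDiffOn ℝ ∞ f U) (hK : K ⊆ U)
    (h : ∀ (α : Fin n →₀ ℕ), ∀ x ∈ K,
      |multiDeriv α f x| ≤ C * ρ ^ (∑ i, α i) * ((∑ i, α i)! : ℝ) * M (∑ i, α i))
    {z w : EuclideanSpace ℝ (Fin n)} (hw : ‖w‖ ≤ 1) {S : Set ℝ} (hS : ∀ t ∈ S, z + t • w ∈ K) :
    IsCMBoundOn M S C (n * ρ) (lineTower f z w) := by
  intro k t ht
  have hb : ∀ r ∈ (Finset.univ : Finset (Fin k → Fin n)),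
      |(∏ j, w (r j)) * wordDeriv (List.ofFn r) f (z + t • w)| ≤
        C * (ρ ^ k * (k ! : ℝ) * M k) := by
    intro r _
    have h1 : |∏ j, w (r j)| ≤ 1 := by
      rw [Finset.abs_prod]
      refine Finset.prod_le_one (fun _ _ => abs_nonneg _) fun j _ => ?_
      exact (PiLp.norm_apply_le w (r j)).trans hw
    have h2 := abs_wordDeriv_le hU hf hK h (List.ofFn r) (hS t ht)
    rw [List.length_ofFn] at h2
    rw [abs_mul]
    exact (mul_le_of_le_one_left (abs_nonneg _) h1).trans h2
  calc |lineTower f z w k t| ≤ _ := Finset.abs_sum_le_sum_abs _ _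
    _ ≤ _ := Finset.sum_le_card_nsmul _ _ _ hb
    _ = _ := by simp [mul_pow]; ring

theorem lineTower_zero (f : EuclideanSpace ℝ (Fin n) → ℝ) (z w : EuclideanSpace ℝ (Fin n))
    (t : ℝ) : lineTower f z w 0 t = f (z + t • w) := by
  simp [lineTower, wordDeriv]

theorem multiDeriv_eq_of_taylorSeriesAt_eq {a : EuclideanSpace ℝ (Fin n)}
    (h : taylorSeriesAt f a = taylorSeriesAt g a) (α : Fin n →₀ ℕ) :
    multiDeriv α f a = multiDeriv α g a := by
  have h1 := congrFun h α
  refine mul_left_cancel₀ (inv_ne_zero (Finset.prod_ne_zero_iff.2 fun i _ => ?_)) h1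
  exact_mod_cast Nat.factorial_ne_zero _

/-- If two smooth functions have the same Taylor series at some point of a connected open set but
are different, then there is a point with the same Taylor series near which they differ. -/
theorem exists_flat_point (hU : IsOpen U) (hc : IsConnected U) {a : EuclideanSpace ℝ (Fin n)}
    (ha : a ∈ U) (hf : ContDiffOn ℝ ∞ f U) (hg : ContDiffOn ℝ ∞ g U)
    (haf : ∀ α, multiDeriv α f a = multiDeriv α g a) (hne : ¬ EqOn f g U) :
    ∃ z ∈ U, (∀ α, multiDeriv α f z = multiDeriv α g z) ∧ ¬ f =ᶠ[𝓝 z] g := by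
  by_contra! hcon
  refine hne fun x hx => ?_
  have hV : IsOpen {z | f =ᶠ[𝓝 z] g} := isOpen_setOfPred_eventually_nhds
  have hsub : U ⊆ {z | f =ᶠ[𝓝 z] g} := by
    -- The set of local agreement is also relatively closed: all derivatives agree at its limit
    -- points by continuity, and `hcon` applies there.
    refine hc.isPreconnected.subset_of_closure_inter_subset hV ⟨a, ha, hcon a ha haf⟩ ?_
    rintro z ⟨hz, hzU⟩
    refine hcon z hzU fun α => ?_
    have heq : EqOn f g {z | f =ᶠ[𝓝 z] g} := fun y hy => hy.self_of_nhds
    refine tendsto_nhds_unique_of_frequently_eq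
      ((hf.multiDeriv hU α).contDiffAt (hU.mem_nhds hzU)).continuousAt
      ((hg.multiDeriv hU α).contDiffAt (hU.mem_nhds hzU)).continuousAt
      ((mem_closure_iff_frequently.1 hz).mono fun y hy => ?_)
    rw [multiDeriv_eq_wordDeriv, multiDeriv_eq_wordDeriv]
    exact EqOn.wordDeriv hV heq _ hy
  exact (hsub hx).self_of_nhds

end Multivariate
/-- Non-quasianalyticity in one variable: there are flat but nonvanishing towers on arbitrarily
short intervals, with uniform bounds. -/
theorem exists_flat_tower_of_not_isQuasianalytic {M : ℕ → ℝ} (hM : IsDCWeight M)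
    (hnq : ¬ IsQuasianalytic M) :
    ∃ C ρ : ℝ, 0 ≤ C ∧ 0 < ρ ∧ ∀ T : ℝ, 0 < T → ∃ (a : ℝ) (q : ℕ → ℝ → ℝ),
      0 < a ∧ 2 * a ≤ T ∧ IsTowerOn (Icc 0 (2 * a)) q ∧
      IsCMBoundOn M (Icc 0 (2 * a)) C ρ q ∧ (∀ k, q k 0 = 0) ∧ q 0 a ≠ 0 := by
  simp only [IsQuasianalytic, not_forall] at hnq
  obtain ⟨n, U, hU, hc, a, ha, f, g, hf, hg, hfg, hne⟩ := hnq
  obtain ⟨z, hzU, hz, hzne⟩ := exists_flat_point hU hc ha hf.1 hg.1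
    (multiDeriv_eq_of_taylorSeriesAt_eq hfg) hne
  obtain ⟨R, hR, hRU⟩ := Metric.nhds_basis_closedBall.mem_iff.1 (hU.mem_nhds hzU)
  obtain ⟨C₁, ρ₁, hC₁, hρ₁, h₁⟩ := hf.2 _ (isCompact_closedBall z R) hRU
  obtain ⟨C₂, ρ₂, hC₂, hρ₂, h₂⟩ := hg.2 _ (isCompact_closedBall z R) hRU
  -- Both constants come from the fixed ball and are chosen before T. The + 1 keeps the rate
  -- positive when n = 0.
  refine ⟨C₁ + C₂, n * (ρ₁ + ρ₂) + 1, by positivity, by positivity, fun T hT => ?_⟩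
  obtain ⟨y, hyne, hy⟩ : ∃ y, f y ≠ g y ∧ y ∈ Metric.ball z (min R T / 2) :=
    ((not_eventually.1 hzne).and_eventually
      (Metric.ball_mem_nhds z (half_pos (lt_min hR hT)))).exists
  have hzy : f z = g z := by
    have := hz 0
    rwa [multiDeriv_eq_wordDeriv, multiDeriv_eq_wordDeriv,
      show ((List.finRange n).flatMap fun i => List.replicate ((0 : Fin n →₀ ℕ) i) i) = [] by
        simp] at this
  have hpos : 0 < ‖y - z‖ := norm_pos_iff.2 (sub_ne_zero.2 fun h => hyne (h ▸ hzy))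
  have hlt : ‖y - z‖ < min R T / 2 := by rwa [← dist_eq_norm]
  set b := ‖y - z‖ with hb
  set w := b⁻¹ • (y - z) with hw
  have hw1 : ‖w‖ = 1 := by
    rw [hw, norm_smul, norm_inv, Real.norm_of_nonneg hpos.le, ← hb, inv_mul_cancel₀ hpos.ne']
  have hK : ∀ t ∈ Icc 0 (2 * b), z + t • w ∈ Metric.closedBall z R := by
    intro t ht
    rw [Metric.mem_closedBall, dist_self_add_left, norm_smul, hw1, mul_one,
      Real.norm_of_nonneg ht.1]
    linarith [ht.2, min_le_left R T]
  have hKU : ∀ t ∈ Icc 0 (2 * b), z + t • w ∈ U := fun t ht => hRU (hK t ht)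
  have hbound : ∀ {h : EuclideanSpace ℝ (Fin n) → ℝ} {C ρ : ℝ}, 0 < C → 0 < ρ → ρ ≤ ρ₁ + ρ₂ →
      IsCMBoundOn M (Icc 0 (2 * b)) C (n * ρ) (lineTower h z w) →
      IsCMBoundOn M (Icc 0 (2 * b)) C (n * (ρ₁ + ρ₂) + 1) (lineTower h z w) := by
    intro h C ρ hC hρ hle hb
    refine hb.mono hM (by positivity) hC.le le_rfl ?_
    have : (n : ℝ) * ρ ≤ n * (ρ₁ + ρ₂) := by gcongr
    linarith
  have hb₁ := hbound hC₁ hρ₁ (by linarith) (isCMBoundOn_lineTower hU hf.1 hRU h₁ hw1.le hK)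
  have hb₂ := hbound hC₂ hρ₂ (by linarith) (isCMBoundOn_lineTower hU hg.1 hRU h₂ hw1.le hK)
  refine ⟨b, fun k t => lineTower f z w k t - lineTower g z w k t, hpos,
    by linarith [min_le_right R T], fun k t ht => (isTowerOn_lineTower hU hf.1 hKU k t ht).sub
      (isTowerOn_lineTower hU hg.1 hKU k t ht), fun k t ht => ?_, fun k => ?_, ?_⟩
  · refine (abs_sub _ _).trans ?_
    rw [add_mul]
    exact add_le_add (hb₁ k t ht) (hb₂ k t ht)
  · rw [sub_eq_zero]
    refine Finset.sum_congr rfl fun r _ => ?_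
    rw [zero_smul, add_zero, wordDeriv_eq_multiDeriv hU hf.1 _ hzU,
      wordDeriv_eq_multiDeriv hU hg.1 _ hzU, hz]
  · have : z + b • w = y := by
      rw [hw, smul_smul, mul_inv_cancel₀ hpos.ne', one_smul, add_sub_cancel]
    change lineTower f z w 0 b - lineTower g z w 0 b ≠ 0
    rw [lineTower_zero, lineTower_zero, this]
    exact sub_ne_zero.2 hyne

/-- For a non-quasianalytic weight sequence there are cut-off functions with arbitrarily small
support which satisfy Denjoy–Carleman estimates with the same `ρ`. -/
theorem exists_cutoff_of_not_isQuasianalytic {M : ℕ → ℝ} (hM : IsDCWeight M)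
    (hnq : ¬ IsQuasianalytic M) :
    ∃ ρ : ℝ, 0 < ρ ∧ ∀ T : ℝ, 0 < T → ∃ (C r : ℝ) (χ : ℕ → ℝ → ℝ), 0 < C ∧ 0 < r ∧
      IsTowerOn univ χ ∧ IsCMBoundOn M univ C ρ χ ∧ (∀ t, |t| ≤ r → χ 0 t = 1) ∧
      ∀ k t, T ≤ |t| → χ k t = 0 := by
  obtain ⟨C, ρ, hC, hρ, H⟩ := exists_flat_tower_of_not_isQuasianalytic hM hnq
  -- The three doublings come from the reflected product, the square and the product of two steps;
  -- integration costs none.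
  refine ⟨2 * (2 * (2 * ρ)), by positivity, fun T hT => ?_⟩
  -- The cut-off reaches out to 4a, twice the length of the flat interval, hence T / 2.
  obtain ⟨a, q, ha, haT, hq, hqb, hq0, hqa⟩ := H (T / 2) (half_pos hT)
  obtain ⟨ψ, hψ, hψb, hnn, hψa, hsupp⟩ := exists_nonneg_bump_of_flat hM hC hρ ha hq hqb hq0 hqa
  obtain ⟨D, P, hD, hP, hPb, hP0, hP1⟩ := exists_step_of_bump hM (by positivity)
    ⟨ha.le, by linarith⟩ (by positivity) hψ hψb hnn hψa hsupp
  obtain ⟨χ, hχ, hχb, h1, h0⟩ := exists_cutoff_of_step hM hD (by positivity) hP hPb hP0 hP1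
  exact ⟨D * D, 2 * a, χ, by positivity, by positivity, hχ, hχb, h1,
    fun k t ht => h0 k t (by linarith)⟩

/-! ### Glueing along the sequence `2 ^ (-j)` -/

section Glue

variable {E : Type*} [AddCommGroup E] [Module ℝ E]

/-- The curves `∑ⱼ p j k • y j`, for scalar functions `p j k` with disjoint supports. -/
noncomputable def glue (p : ℕ → ℕ → ℝ → ℝ) (y : ℕ → E) (k : ℕ) (t : ℝ) : E :=
  ∑ᶠ j, p j k t • y j

/-- Each `p j` is supported in the interval of radius `2 ^ (-j) / 8` around `2 ^ (-j)`. -/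
def IsDyadicallySupported (p : ℕ → ℕ → ℝ → ℝ) : Prop :=
  ∀ j k t, (1 / 2 : ℝ) ^ j / 8 ≤ |t - (1 / 2 : ℝ) ^ j| → p j k t = 0

theorem half_pow_succ_le {i j : ℕ} (h : i < j) : (1 / 2 : ℝ) ^ j ≤ (1 / 2 : ℝ) ^ i / 2 := by
  have : (1 / 2 : ℝ) ^ j ≤ (1 / 2 : ℝ) ^ (i + 1) :=
    pow_le_pow_of_le_one (by norm_num) (by norm_num) h
  rw [pow_succ] at this
  linarith

/-- Two centres differ by at least half the larger one, which exceeds the sum of the radii, so the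
supports are disjoint. -/
theorem IsDyadicallySupported.glue_eq {p : ℕ → ℕ → ℝ → ℝ} (hp : IsDyadicallySupported p)
    (y : ℕ → E) {i : ℕ} {t : ℝ} (ht : |t - (1 / 2 : ℝ) ^ i| < (1 / 2 : ℝ) ^ i / 8) (k : ℕ) :
    glue p y k t = p i k t • y i := by
  refine finsum_eq_single _ i fun j hj => ?_
  rw [hp j k t, zero_smul]
  have hi : 0 < (1 / 2 : ℝ) ^ i := by positivity
  have hj' : 0 < (1 / 2 : ℝ) ^ j := by positivity
  obtain ⟨h1, h2⟩ := abs_lt.1 ht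
  rcases lt_or_gt_of_ne hj with h | h
  · have := half_pow_succ_le h
    rw [le_abs]; right; linarith
  · have := half_pow_succ_le h
    rw [le_abs]; left; linarith

/-- This reduces estimates on the vector-valued sum to scalar ones, since `y` will range in a
bounded set. -/
theorem IsDyadicallySupported.exists_glue_eq {p : ℕ → ℕ → ℝ → ℝ} (hp : IsDyadicallySupported p)
    (y : ℕ → E) (k : ℕ) (t : ℝ) : ∃ j, glue p y k t = p j k t • y j := by
  by_cases h : ∃ i : ℕ, |t - (1 / 2 : ℝ) ^ i| < (1 / 2 : ℝ) ^ i / 8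
  · obtain ⟨i, hi⟩ := h
    exact ⟨i, hp.glue_eq y hi k⟩
  · push Not at h
    have h0 : ∀ j, p j k t = 0 := fun j => hp j k t (h j)
    exact ⟨0, by simp [glue, h0]⟩

/-- On the support 2^(-j) ≤ 2t, so 4^(-j) ≤ 4t². The bound is uniform in j, as needed at t = 0. -/
theorem IsDyadicallySupported.abs_le {p : ℕ → ℕ → ℝ → ℝ} (hp : IsDyadicallySupported p)
    {k : ℕ} {B : ℝ} (hB : ∀ j t, |p j k t| ≤ (1 / 4 : ℝ) ^ j * B) (j : ℕ) (t : ℝ) :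
    |p j k t| ≤ 4 * B * t ^ 2 := by
  have hB0 : 0 ≤ B := by simpa using (abs_nonneg _).trans (hB 0 0)
  by_cases ht : (1 / 2 : ℝ) ^ j / 8 ≤ |t - (1 / 2 : ℝ) ^ j|
  · rw [hp j k t ht, abs_zero]; positivity
  · have hj : 0 < (1 / 2 : ℝ) ^ j := by positivity
    have h1 := (abs_lt.1 (not_le.1 ht)).1
    have h2 : (1 / 2 : ℝ) ^ j ≤ 2 * t := by linarith
    calc |p j k t| ≤ (1 / 4 : ℝ) ^ j * B := hB j t
      _ = ((1 / 2 : ℝ) ^ j) ^ 2 * B := by rw [← pow_mul, mul_comm j, pow_mul]; norm_num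
      _ ≤ (2 * t) ^ 2 * B := by gcongr
      _ = _ := by ring

theorem IsDyadicallySupported.glue_eq_sum {p : ℕ → ℕ → ℝ → ℝ} (hp : IsDyadicallySupported p)
    (y : ℕ → E) {N : ℕ} {t : ℝ} (ht : 2 * (1 / 2 : ℝ) ^ N ≤ |t|) (k : ℕ) :
    glue p y k t = ∑ j ∈ Finset.range N, p j k t • y j := by
  refine finsum_eq_sum_of_support_subset _ fun j hj => ?_
  rw [Finset.coe_range, mem_Iio]
  by_contra! hN
  refine hj ?_
  have hj : 0 < (1 / 2 : ℝ) ^ j := by positivity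
  have h1 : (1 / 2 : ℝ) ^ j ≤ (1 / 2 : ℝ) ^ N :=
    pow_le_pow_of_le_one (by norm_num) (by norm_num) hN
  change p j k t • y j = 0
  rw [hp j k t, zero_smul]
  have := abs_sub_abs_le_abs_sub t ((1 / 2 : ℝ) ^ j)
  rw [abs_of_pos hj] at this
  linarith

variable [TopologicalSpace E]

theorem isVonNBounded_smul_of_abs_le [ContinuousSMul ℝ E] {S : Set E} (hS : Bornology.IsVonNBounded ℝ S) (B : ℝ) :
    Bornology.IsVonNBounded ℝ {x : E | ∃ a : ℝ, |a| ≤ B ∧ ∃ y ∈ S, x = a • y} := by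
  refine Bornology.isVonNBounded_of_smul_tendsto_zero (l := atTop)
    (ε := fun n : ℕ => 1 / ((n : ℝ) + 1)) (.of_forall fun n => by positivity) fun x hx => ?_
  choose a ha y hy hxy using hx
  have h0 : Tendsto (fun n : ℕ => (1 / ((n : ℝ) + 1)) * a n) atTop (𝓝 0) := by
    refine squeeze_zero_norm (a := fun n : ℕ => 1 / ((n : ℝ) + 1) * B) (fun n => ?_)
      (by simpa using tendsto_one_div_add_atTop_nhds_zero_nat.mul_const B)
    rw [norm_mul, Real.norm_of_nonneg (by positivity : 0 ≤ 1 / ((n : ℝ) + 1))]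
    exact mul_le_mul_of_nonneg_left (ha n) (by positivity)
  refine (hS.smul_tendsto_zero (.of_forall hy) h0).congr fun n => ?_
  simp [hxy, smul_smul]

/-- The glued curves form a derivative tower: away from `0` they are finite sums, and at `0` the
coefficients are `O(t²)`. -/
theorem isCurveDeriv_glue [IsTopologicalAddGroup E] [ContinuousSMul ℝ E] {M : ℕ → ℝ} {B ρ : ℝ} {p : ℕ → ℕ → ℝ → ℝ}
    (hp : IsDyadicallySupported p) (hd : ∀ j, IsTowerOn univ (p j))
    (hb : ∀ j, IsCMBoundOn M univ ((1 / 4 : ℝ) ^ j * B) ρ (p j)) {y : ℕ → E}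
    (hy : Bornology.IsVonNBounded ℝ (range y)) (k : ℕ) :
    IsCurveDeriv (glue p y k) (glue p y (k + 1)) := by
  have hle : ∀ k j t, |p j k t| ≤ 4 * (B * (ρ ^ k * (k ! : ℝ) * M k)) * t ^ 2 := fun k =>
    hp.abs_le fun j t => (hb j k t trivial).trans_eq (mul_assoc _ _ _)
  intro t
  rcases eq_or_ne t 0 with rfl | ht
  · have hz : ∀ k, glue p y k 0 = 0 := by
      intro k
      obtain ⟨j, hj⟩ := hp.exists_glue_eq y k 0
      have : p j k 0 = 0 := by simpa using hle k j 0
      rw [hj, this, zero_smul]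
    simp only [hz, zero_add, sub_zero]
    choose j hj using hp.exists_glue_eq y k
    set D := 4 * (B * (ρ ^ k * (k ! : ℝ) * M k)) with hD
    have h0 : Tendsto (fun h => h⁻¹ * p (j h) k h) (𝓝[≠] 0) (𝓝 0) := by
      refine squeeze_zero_norm (a := fun h => D * |h|) (fun h => ?_) ?_
      · rcases eq_or_ne h 0 with rfl | hh
        · simp
        · rw [norm_mul, norm_inv, Real.norm_eq_abs, Real.norm_eq_abs,
            inv_mul_le_iff₀ (abs_pos.2 hh)]
          refine (hle k (j h) h).trans_eq ?_
          rw [← sq_abs h]; ring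
      · have : Tendsto (fun h : ℝ => D * |h|) (𝓝 0) (𝓝 (D * |0|)) :=
          (continuous_const.mul continuous_abs).tendsto _
        simp only [abs_zero, mul_zero] at this
        exact this.mono_left nhdsWithin_le_nhds
    refine (hy.smul_tendsto_zero (x := fun h => y (j h))
      (.of_forall fun h => mem_range_self _) h0).congr fun h => ?_
    simp [hj, smul_smul]
  -- The quarter leaves room for one N to serve both t and all nearby t + h.
  · obtain ⟨N, hN⟩ := exists_pow_lt_of_lt_one (show 0 < |t| / 4 by positivity)
      (show (1 / 2 : ℝ) < 1 by norm_num)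
    have ht' : 2 * (1 / 2 : ℝ) ^ N ≤ |t| := by linarith [abs_nonneg t]
    have hev : ∀ᶠ h in 𝓝[≠] (0 : ℝ), 2 * (1 / 2 : ℝ) ^ N ≤ |t + h| := by
      have hc : Tendsto (fun h : ℝ => |t + h|) (𝓝 0) (𝓝 |t + 0|) :=
        (continuous_abs.comp (continuous_const.add continuous_id)).tendsto _
      rw [add_zero] at hc
      exact nhdsWithin_le_nhds ((hc.eventually (lt_mem_nhds (show |t| / 2 < |t| by
        linarith [abs_pos.2 ht]))).mono fun h hh => by linarith)
    rw [hp.glue_eq_sum y ht', hp.glue_eq_sum y ht']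
    refine (tendsto_finsetSum (Finset.range N) fun j _ =>
      ((hasDerivAt_iff_tendsto_slope_zero.1 (hd j k t trivial)).smul_const (y j))).congr' ?_
    filter_upwards [hev] with h hh
    rw [hp.glue_eq_sum y hh, ← Finset.sum_sub_distrib, Finset.smul_sum]
    refine Finset.sum_congr rfl fun j _ => ?_
    rw [← sub_smul, smul_smul, smul_eq_mul]

theorem isVonNBounded_glue [ContinuousSMul ℝ E] {M : ℕ → ℝ} (hM : IsDCWeight M) {B ρ : ℝ} (hρ : 0 < ρ)
    {p : ℕ → ℕ → ℝ → ℝ} (hp : IsDyadicallySupported p)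
    (hb : ∀ j, IsCMBoundOn M univ ((1 / 4 : ℝ) ^ j * B) ρ (p j)) {y : ℕ → E}
    (hy : Bornology.IsVonNBounded ℝ (range y)) :
    Bornology.IsVonNBounded ℝ
      {z : E | ∃ (k : ℕ) (x : ℝ), z = (ρ ^ k * (k ! : ℝ) * M k)⁻¹ • glue p y k x} := by
  refine (isVonNBounded_smul_of_abs_le hy B).subset ?_
  rintro _ ⟨k, x, rfl⟩
  obtain ⟨j, hj⟩ := hp.exists_glue_eq y k x
  have hW : 0 < ρ ^ k * (k ! : ℝ) * M k := by have := hM.pos k; positivity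
  refine ⟨(ρ ^ k * (k ! : ℝ) * M k)⁻¹ * p j k x, ?_, y j, mem_range_self _, by
    rw [hj, smul_smul]⟩
  have h1 := hb j k x trivial
  have h2 : (1 / 4 : ℝ) ^ j ≤ 1 := pow_le_one₀ (by norm_num) (by norm_num)
  have hB : 0 ≤ B := by
    have := (abs_nonneg _).trans h1
    rw [mul_assoc] at this
    have h3 := nonneg_of_mul_nonneg_right this (by positivity)
    exact nonneg_of_mul_nonneg_left h3 hW
  rw [abs_mul, abs_of_pos (inv_pos.2 hW), inv_mul_le_iff₀ hW]
  refine h1.trans ?_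
  rw [mul_comm _ B]
  nlinarith [mul_le_of_le_one_right hB h2]

theorem IsCurveDeriv.add [IsTopologicalAddGroup E] {c c' e e' : ℝ → E} (hc : IsCurveDeriv c c') (he : IsCurveDeriv e e') :
    IsCurveDeriv (fun t => c t + e t) fun t => c' t + e' t := fun t =>
  ((hc t).add (he t)).congr fun h => by rw [← smul_add, sub_add_sub_comm]

theorem isCurveDeriv_const (x : E) : IsCurveDeriv (fun _ => x) fun _ => 0 := fun t => by
  simpa using tendsto_const_nhds

end Glue

/-! ### Linear terms and assembly of the curve -/

/-- Multiplication of a tower by the identity function. -/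
theorem IsTowerOn.id_mul {χ : ℕ → ℝ → ℝ} (hχ : IsTowerOn univ χ) :
    IsTowerOn univ fun k t => t * χ k t + k * χ (k - 1) t := by
  rintro (_ | k) t -
  · simpa [add_comm] using (hasDerivAt_id' t).fun_mul (hχ 0 t trivial)
  · refine (((hasDerivAt_id t).mul (hχ (k + 1) t trivial)).add
      ((hχ k t trivial).const_mul ((k + 1 : ℕ) : ℝ))).congr_deriv ?_
    simp only [id, Nat.add_sub_cancel]
    push_cast
    ring

/-- On the support |t| ≤ 1. In the other term k (k-1)! = k! and M (k-1) ≤ M k, and the missing power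
of ρ gives ρ⁻¹. At k = 0 the truncated k - 1 is killed by the factor k. -/
theorem IsCMBoundOn.id_mul {M : ℕ → ℝ} (hM : IsDCWeight M) {C ρ : ℝ} (hρ : 0 < ρ)
    {χ : ℕ → ℝ → ℝ} (hχ : IsCMBoundOn M univ C ρ χ) (hsupp : ∀ k t, 1 ≤ |t| → χ k t = 0) :
    IsCMBoundOn M univ (C * (1 + ρ⁻¹)) ρ fun k t => t * χ k t + k * χ (k - 1) t := by
  intro k t _
  have hC : 0 ≤ C := by simpa [hM.zero] using (abs_nonneg _).trans (hχ 0 0 trivial)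
  have h1 : |t * χ k t| ≤ C * (ρ ^ k * (k ! : ℝ) * M k) := by
    rw [abs_mul]
    by_cases ht : 1 ≤ |t|
    · have := hM.pos k
      rw [hsupp k t ht, abs_zero, mul_zero]; positivity
    · exact (mul_le_of_le_one_left (abs_nonneg _) (not_le.1 ht).le).trans (hχ k t trivial)
  have h2 : |(k : ℝ) * χ (k - 1) t| ≤ C * ρ⁻¹ * (ρ ^ k * (k ! : ℝ) * M k) := by
    rcases k with _ | k
    · simp [hM.zero]; positivity
    · have hMk := hM.pos k
      rw [abs_mul, Nat.abs_cast, Nat.add_sub_cancel]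
      calc ((k + 1 : ℕ) : ℝ) * |χ k t|
          ≤ ((k + 1 : ℕ) : ℝ) * (C * (ρ ^ k * (k ! : ℝ) * M k)) := by
            gcongr; exact hχ k t trivial
        _ ≤ ((k + 1 : ℕ) : ℝ) * (C * (ρ ^ k * (k ! : ℝ) * M (k + 1))) := by
            gcongr; exact hM.mono k
        _ = _ := by rw [Nat.factorial_succ, pow_succ]; push_cast; field_simp
  refine (abs_add_le _ _).trans ?_
  linarith

theorem lemma3p6 (M : ℕ → ℝ) (hM : IsDCWeight M) (hnq : ¬ IsQuasianalytic M) :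
    ∃ (lam t s : ℕ → ℝ) (tinf : ℝ),
      (∀ k, 0 < lam k) ∧ Antitone lam ∧ Tendsto lam atTop (𝓝 0) ∧
      Tendsto t atTop (𝓝 tinf) ∧ (∀ k, 0 < s k) ∧
      ∀ (E : Type*) [AddCommGroup E] [Module ℝ E] [TopologicalSpace E]
        [IsTopologicalAddGroup E] [ContinuousSMul ℝ E] [LocallyConvexSpace ℝ E] [T2Space E],
        IsConvenient E →
        ∀ (x v : ℕ → E) (xinf : E),
          MackeyConverges (fun n => (lam n)⁻¹) x xinf →
          MackeyConverges (fun n => (lam n)⁻¹) v 0 →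
          ∃ c : ℝ → E, IsStronglyUniformlyCM M c ∧
            ∀ (k : ℕ) (τ : ℝ), |τ| ≤ s k → c (t k + τ) = x k + τ • v k := by
  obtain ⟨ρ, hρ, H⟩ := exists_cutoff_of_not_isQuasianalytic hM hnq
  choose C r χ hC hr hχ hχb hχ1 hχ0 using fun j : ℕ =>
    H ((1 / 2 : ℝ) ^ j / 8) (by positivity)
  -- The factor (1 + C j)⁻¹ compensates the constant of the j-th cut-off; taking the product over
  -- all i ≤ j makes the sequence decreasing.
  set lam : ℕ → ℝ := fun j => (1 / 4 : ℝ) ^ j * ∏ i ∈ Finset.range (j + 1), (1 + C i)⁻¹ with hlam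
  have hinv : ∀ i, 0 < (1 + C i)⁻¹ := fun i => inv_pos.2 (by linarith [hC i])
  have hinv1 : ∀ i, (1 + C i)⁻¹ ≤ 1 := fun i => inv_le_one_of_one_le₀ (by linarith [hC i])
  have hprod : ∀ m, 0 < ∏ i ∈ Finset.range m, (1 + C i)⁻¹ := fun m =>
    Finset.prod_pos fun i _ => hinv i
  have hprod1 : ∀ m, ∏ i ∈ Finset.range m, (1 + C i)⁻¹ ≤ 1 := fun m =>
    Finset.prod_le_one (fun i _ => (hinv i).le) fun i _ => hinv1 i
  have hpos : ∀ j, 0 < lam j := fun j => mul_pos (by positivity) (hprod _)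
  have hlamC : ∀ j, lam j * C j ≤ (1 / 4 : ℝ) ^ j := by
    intro j
    have h1 : (1 + C j)⁻¹ * C j ≤ 1 := by
      rw [inv_mul_le_iff₀ (by linarith [hC j])]; linarith
    have h2 : (∏ i ∈ Finset.range j, (1 + C i)⁻¹) * ((1 + C j)⁻¹ * C j) ≤ 1 :=
      mul_le_one₀ (hprod1 j) (mul_pos (hinv j) (hC j)).le h1
    simp only [hlam]
    rw [Finset.prod_range_succ, mul_assoc, mul_assoc]
    exact mul_le_of_le_one_right (by positivity) h2
  refine ⟨lam, fun j => (1 / 2 : ℝ) ^ j, r, 0, hpos, ?_, ?_, ?_, hr, ?_⟩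
  · refine antitone_nat_of_succ_le fun j => ?_
    refine mul_le_mul (pow_le_pow_of_le_one (by norm_num) (by norm_num) (Nat.le_succ j)) ?_
      (hprod _).le (by positivity)
    rw [Finset.prod_range_succ _ (j + 1)]
    exact mul_le_of_le_one_right (hprod _).le (hinv1 _)
  · exact squeeze_zero (fun j => (hpos j).le)
      (fun j => mul_le_of_le_one_right (by positivity) (hprod1 _))
      (tendsto_pow_atTop_nhds_zero_of_lt_one (by norm_num) (by norm_num))
  · exact tendsto_pow_atTop_nhds_zero_of_lt_one (by norm_num) (by norm_num)
  intro E _ _ _ _ _ _ _ _ x v xinf hx hv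
  -- The derivatives of t χⱼ(t), which carry the linear part τ vⱼ.
  set θ : ℕ → ℕ → ℝ → ℝ := fun j k t => t * χ j k t + k * χ j (k - 1) t with hθ
  have hsc : ∀ (d : ℕ → ℕ → ℝ → ℝ) (B : ℝ), 0 ≤ B →
      (∀ j, IsTowerOn univ (d j)) → (∀ j, IsCMBoundOn M univ (C j * B) ρ (d j)) →
      (∀ j k t, (1 / 2 : ℝ) ^ j / 8 ≤ |t| → d j k t = 0) →
      IsDyadicallySupported (fun j k t => lam j * d j k (t - (1 / 2 : ℝ) ^ j)) ∧
      (∀ j, IsTowerOn univ fun k t => lam j * d j k (t - (1 / 2 : ℝ) ^ j)) ∧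
      ∀ j, IsCMBoundOn M univ ((1 / 4 : ℝ) ^ j * B) ρ
        fun k t => lam j * d j k (t - (1 / 2 : ℝ) ^ j) := by
    intro d B hB hd hdb hds
    refine ⟨fun j k t ht => mul_eq_zero_of_right _ (hds j k _ ht), fun j k t _ =>
      (((hd j k (t - (1 / 2 : ℝ) ^ j) trivial).comp_sub_const _ _).const_mul (lam j)),
      fun j k t _ => ?_⟩
    have hMk := hM.pos k
    rw [abs_mul, abs_of_pos (hpos j)]
    calc lam j * |d j k (t - (1 / 2 : ℝ) ^ j)|
        ≤ lam j * (C j * B * (ρ ^ k * (k ! : ℝ) * M k)) :=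
          mul_le_mul_of_nonneg_left (hdb j k _ trivial) (hpos j).le
      _ = (lam j * C j) * (B * (ρ ^ k * (k ! : ℝ) * M k)) := by ring
      _ ≤ (1 / 4 : ℝ) ^ j * (B * (ρ ^ k * (k ! : ℝ) * M k)) := by gcongr; exact hlamC j
      _ = _ := by ring
  have hT1 : ∀ j : ℕ, (1 / 2 : ℝ) ^ j / 8 ≤ 1 := fun j => by
    have : (1 / 2 : ℝ) ^ j ≤ 1 := pow_le_one₀ (by norm_num) (by norm_num)
    linarith
  obtain ⟨hA0, hA1, hA2⟩ := hsc χ 1 zero_le_one hχ (fun j => by simpa using hχb j) hχ0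
  obtain ⟨hB0, hB1, hB2⟩ := hsc θ (1 + ρ⁻¹) (by positivity) (fun j => (hχ j).id_mul)
    (fun j => (hχb j).id_mul hM hρ fun k t ht => hχ0 j k t ((hT1 j).trans ht))
    (fun j k t ht => by simp [hθ, hχ0 j _ t ht])
  set A : ℕ → ℕ → ℝ → ℝ := fun j k t => lam j * χ j k (t - (1 / 2 : ℝ) ^ j) with hA
  set B : ℕ → ℕ → ℝ → ℝ := fun j k t => lam j * θ j k (t - (1 / 2 : ℝ) ^ j) with hB
  set X : ℕ → E := fun j => (lam j)⁻¹ • (x j - xinf) with hX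
  set V : ℕ → E := fun j => (lam j)⁻¹ • (v j - 0) with hV
  -- The factors λⱼ in `A`, `B` cancel those in the bounded sequences `X`, `V`; x_∞ only enters in
  -- order 0.
  set d : ℕ → ℝ → E := fun k t => (if k = 0 then xinf else 0) + glue A X k t + glue B V k t with hd
  refine ⟨d 0, ⟨d, ⟨rfl, fun k => ?_⟩, ρ, hρ, ?_⟩, fun k τ hτ => ?_⟩
  · have hc : IsCurveDeriv (fun _ : ℝ => if k = 0 then xinf else 0)
        (fun _ => if k + 1 = 0 then xinf else 0) := isCurveDeriv_const _
    exact (hc.add (isCurveDeriv_glue hA0 hA1 hA2 hx k)).add (isCurveDeriv_glue hB0 hB1 hB2 hv k)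
  · have hfin : Bornology.IsVonNBounded ℝ ({xinf, 0} : Set E) :=
      (Set.toFinite _).isVonNBounded
    refine ((hfin.add (isVonNBounded_glue hM hρ hA0 hA2 hx)).add
      (isVonNBounded_glue hM hρ hB0 hB2 hv)).subset ?_
    rintro _ ⟨k, s, rfl⟩
    simp only [hd, smul_add]
    refine add_mem_add (add_mem_add ?_ ⟨k, s, rfl⟩) ⟨k, s, rfl⟩
    rcases eq_or_ne k 0 with rfl | hk
    · simp [hM.zero]
    · simp [hk]
  -- Otherwise χₖ(τ) would be both 1 and 0. Hence only the k-th term is active at tₖ + τ.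
  · have hlt : |τ| < (1 / 2 : ℝ) ^ k / 8 := by
      by_contra! h
      exact one_ne_zero ((hχ1 k τ hτ).symm.trans (hχ0 k 0 τ h))
    have hmem : |(1 / 2 : ℝ) ^ k + τ - (1 / 2 : ℝ) ^ k| < (1 / 2 : ℝ) ^ k / 8 := by
      rwa [add_sub_cancel_left]
    simp only [hd]
    rw [hA0.glue_eq X hmem, hB0.glue_eq V hmem]
    simp only [hA, hB, hθ, hX, hV, add_sub_cancel_left, hχ1 k τ hτ, smul_smul, sub_zero]
    have hne := (hpos k).ne'
    simp [mul_right_comm (lam k) τ, hne]
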